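/- Let $\mathbb T=\mathbb R/\mathbb Z$ (with Haar measure of mass one), let $\mathcal M(\mathbb T)=C(\mathbb T)^*$ be the space of real Radon measures with the total variation norm $\|\cdot\|_{TV}$, and let $\varphi\in C^2(\mathbb T,\mathbb R)$. Define $\Phi:\mathcal M(\mathbb T)\to L^2(\mathbb T)$ and $\Phi^*:L^2(\mathbb T)\to C(\mathbb T)$ by $$\Phi m(t)=\int_{\mathbb T}\varphi(x-t)\,dm(x),\qquad \Phi^*p(t)=\int_{\mathbb T}\varphi(t-x)p(x)\,dx .$$ Let $m_0=\sum_{i=1}^N a_{0,i}\delta_{x_{0,i}}$ with all $a_{0,i}\in\mathbb R\setminus\{0\}$ and the $x_{0,i}\in\mathbb T$ pairwise distinct, and let $y=\Phi m_0$. Let $\Gamma_{x_0}:\mathbb R^N\times\mathbb R^N\to L^2(\mathbb T)$, $$\Gamma_{x_0}(u,v)=\sum_{i=1}^N\bigl(u_i\,\varphi(x_{0,i}-\cdot)+v_i\,\varphi'(x_{0,i}-\cdot)\bigr).$$ The minimal-norm certificate is $\eta_0=\Phi^*p_0$, where $p_0$ is the solution of minimal $L^2$ norm of the dual problem $\sup\{\langle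 y,p\rangle:\ p\in L^2(\mathbb T),\ \|\Phi^*p\|_\infty\le 1\}$. The vanishing derivative pre-certificate is $\eta_V=\Phi^*p_V$, where $p_V$ has minimal $L^2$ norm among all $p\in L^2(\mathbb T)$ such that $(\Phi^*p)(x_{0,i})=\operatorname{sign}(a_{0,i})$ and $(\Phi^*p)'(x_{0,i})=0$ for $1\le i\le N$. Assume that $\Gamma_{x_0}$ has full rank (is injective) and that $m_0$ satisfies the Non Degenerate Source Condition: there is $p\in L^2(\mathbb T)$ with $\Phi^*p\in\partial\|m_0\|_{TV}$, i.e. $\|m\|_{TV}\ge\|m_0\|_{TV}+\int\Phi^*p\,d(m-m_0)$ for all $m\in\mathcal M(\mathbb T)$; and the minimal-norm certificate satisfies $|\eta_0(s)|<1$ for all $s\in\mathbb T\setminus\{x_{0,1},\dots,x_{0,N}\}$ and $\eta_0''(x_{0,i})\ne0$ for all $i$. Then $p_0$ and $p_V$ exist and are unique, $\Gamma_{x_0}^*\Gamma_{x_0}$ is invertible, and $$\eta_V=\eta_0=\Phi^*\,\Gamma_{x_0}(\Gamma_{x_0}^*\Gamma_{x_0})^{-1}\begin{pmatrix}\operatorname{sign}(a_0)\\0\end{pmatrix}.$$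 -/

import Mathlib

noncomputable section

open MeasureTheory

namespace SparseSpikes

/-- The one-dimensional torus `𝕋 = ℝ / ℤ`, with its Haar measure of total mass one. -/
abbrev Torus : Type := UnitAddCircle

/-- The real Hilbert space `L²(𝕋)`. -/
abbrev L2 : Type := Lp ℝ 2 (volume : Measure Torus)

/-- Radon measures on `𝕋`: the dual of `C(𝕋)`. The dual norm is the total variation,
and the value `m ψ` is the integral of `ψ` against `m`. -/
abbrev RadonMeasure : Type := C(Torus, ℝ) →L[ℝ] ℝ

/-- The derivative of a function on the torus. -/
def torusDeriv (g : Torus → ℝ) (x : Torus) : ℝ :=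
  deriv (fun h : ℝ => g (x + (h : Torus))) 0

/-- Functions of class `C²` on the torus: those whose `1`-periodic lift to `ℝ` is `C²`. -/
structure C2Torus where
  toFun : Torus → ℝ
  contDiff : ContDiff ℝ 2 (fun t : ℝ => toFun (t : Torus))

namespace C2Torus

theorem continuous_of_lift {g : Torus → ℝ} (h : Continuous (fun t : ℝ => g (t : Torus))) :
    Continuous g :=
  (QuotientAddGroup.isQuotientMap_mk (N := AddSubgroup.zmultiples (1 : ℝ))).continuous_iff.2 h

theorem torusDeriv_coe (g : Torus → ℝ) (t : ℝ) :
    torusDeriv g (t : Torus) = deriv (fun s : ℝ => g (s : Torus)) t := by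
  have h := deriv_comp_const_add (f := fun s : ℝ => g (s : Torus)) t 0
  simp only [add_zero] at h
  rw [← h, torusDeriv]
  simp only [AddCircle.coe_add]

/-- The function itself, as an element of `C(𝕋)`. -/
def cont (φ : C2Torus) : C(Torus, ℝ) :=
  ⟨φ.toFun, continuous_of_lift φ.contDiff.continuous⟩

/-- The derivative `φ'`, as an element of `C(𝕋)`. -/
def contDeriv (φ : C2Torus) : C(Torus, ℝ) :=
  ⟨torusDeriv φ.toFun, continuous_of_lift (by
    simp only [torusDeriv_coe]
    exact φ.contDiff.continuous_deriv (by norm_num))⟩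

end C2Torus

/-- The operator `Φ : 𝓜(𝕋) → L²(𝕋)`, `Φ m : t ↦ ∫ φ(x - t) dm(x)`. -/
def Phi (φ : C2Torus) (m : RadonMeasure) : L2 :=
  ContinuousMap.toLp 2 volume ℝ
    ⟨fun t : Torus => m ⟨fun x : Torus => φ.cont (x - t), by fun_prop⟩,
      m.continuous.comp (ContinuousMap.curry
        ⟨fun q : Torus × Torus => φ.cont (q.2 - q.1), by fun_prop⟩).continuous⟩

theorem continuous_phiAdj (φ : C2Torus) (p : L2) :
    Continuous (fun t : Torus => ∫ x : Torus, φ.cont (t - x) * p x) := by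
  have hp : Integrable (fun x : Torus => p x) volume :=
    (Lp.memLp p).integrable (by norm_num)
  refine continuous_of_dominated (bound := fun x => ‖φ.cont‖ * ‖p x‖) ?_ ?_ ?_ ?_
  · intro t
    have h : Continuous (fun x : Torus => φ.cont (t - x)) := by fun_prop
    exact h.aestronglyMeasurable.mul hp.aestronglyMeasurable
  · intro t
    refine Filter.Eventually.of_forall fun x => ?_
    rw [norm_mul]
    exact mul_le_mul_of_nonneg_right (φ.cont.norm_coe_le_norm _) (norm_nonneg _)
  · exact hp.norm.const_mul _
  · refine Filter.Eventually.of_forall fun x => ?_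
    fun_prop

/-- The adjoint `Φ* : L²(𝕋) → C(𝕋)`, `Φ* p : t ↦ ∫ φ(t - x) p(x) dx`. -/
def PhiAdj (φ : C2Torus) (p : L2) : C(Torus, ℝ) :=
  ⟨fun t : Torus => ∫ x : Torus, φ.cont (t - x) * p x, continuous_phiAdj φ p⟩

/-- The discrete measure `m_{a,x} = ∑ᵢ aᵢ δ_{xᵢ}`. -/
def discreteMeasure {N : ℕ} (a : Fin N → ℝ) (x : Fin N → Torus) : RadonMeasure :=
  ∑ i, a i • ContinuousMap.evalCLM ℝ (x i)

/-- The subdifferential of the total variation at `m`. -/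
def subdiffTV (m : RadonMeasure) : Set C(Torus, ℝ) :=
  {η | ∀ m' : RadonMeasure, ‖m‖ + (m' - m) η ≤ ‖m'‖}

/-- The solutions of the dual problem `sup {⟨y, p⟩ : ‖Φ* p‖_∞ ≤ 1}`. -/
def dualSolutions (φ : C2Torus) (y : L2) : Set L2 :=
  {p | ‖PhiAdj φ p‖ ≤ 1 ∧ ∀ q : L2, ‖PhiAdj φ q‖ ≤ 1 → inner ℝ y q ≤ inner ℝ y p}

/-- `p` is an element of minimal norm of `S`. -/
def IsMinNorm (S : Set L2) (p : L2) : Prop :=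
  p ∈ S ∧ ∀ q ∈ S, ‖p‖ ≤ ‖q‖

/-- `η₀ = Φ* p₀`, where `p₀` is the dual solution of minimal norm for the observation `y`. -/
def IsMinNormCertificate (φ : C2Torus) (y : L2) (η₀ : C(Torus, ℝ)) : Prop :=
  ∃ p₀, IsMinNorm (dualSolutions φ y) p₀ ∧ η₀ = PhiAdj φ p₀

/-- The constraints `(Φ* p)(xᵢ) = sign aᵢ` and `(Φ* p)'(xᵢ) = 0`. -/
def vanishingConstraints (φ : C2Torus) {N : ℕ} (a : Fin N → ℝ) (x : Fin N → Torus) : Set L2 :=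
  {p | ∀ i, PhiAdj φ p (x i) = Real.sign (a i) ∧ torusDeriv (PhiAdj φ p) (x i) = 0}

/-- `ηV = Φ* pV`, where `pV` has minimal norm among the `p` satisfying the constraints. -/
def IsVanishingDerivativePrecertificate (φ : C2Torus) {N : ℕ} (a : Fin N → ℝ)
    (x : Fin N → Torus) (ηV : C(Torus, ℝ)) : Prop :=
  ∃ pV, IsMinNorm (vanishingConstraints φ a x) pV ∧ ηV = PhiAdj φ pV

/-- The source condition: some `Φ* p` lies in the subdifferential of the total variation. -/
def SourceCondition (φ : C2Torus) (m : RadonMeasure) : Prop :=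
  ∃ p : L2, PhiAdj φ p ∈ subdiffTV m

/-- The non degenerate source condition for `m_{a,x}`. The minimal-norm certificate exists and
is unique as soon as the source condition holds. -/
def NonDegenerateSourceCondition (φ : C2Torus) {N : ℕ} (a : Fin N → ℝ)
    (x : Fin N → Torus) : Prop :=
  SourceCondition φ (discreteMeasure a x) ∧
    ∀ η₀, IsMinNormCertificate φ (Phi φ (discreteMeasure a x)) η₀ →
      (∀ s, s ∉ Set.range x → |η₀ s| < 1) ∧
        ∀ i, torusDeriv (torusDeriv η₀) (x i) ≠ 0

/-- The function `t ↦ ψ(x - t)` as an element of `L²(𝕋)`. -/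
def atom (ψ : C(Torus, ℝ)) (x : Torus) : L2 :=
  ContinuousMap.toLp 2 volume ℝ ⟨fun t : Torus => ψ (x - t), by fun_prop⟩

/-- The operator `a ↦ ∑ᵢ aᵢ ψ(xᵢ - ·)`; it is `Φ_x` for `ψ = φ` and `Φ'_x` for `ψ = φ'`. -/
def spikeOp (ψ : C(Torus, ℝ)) {N : ℕ} (x : Fin N → Torus) :
    EuclideanSpace ℝ (Fin N) →L[ℝ] L2 :=
  ∑ i, (EuclideanSpace.proj i : EuclideanSpace ℝ (Fin N) →L[ℝ] ℝ).smulRight (atom ψ (x i))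

/-- The Euclidean space `ℝᴺ × ℝᴺ = ℝ²ᴺ`. -/
abbrev PairSpace (N : ℕ) : Type :=
  WithLp 2 (EuclideanSpace ℝ (Fin N) × EuclideanSpace ℝ (Fin N))

/-- `Γ_x = (Φ_x, Φ'_x) : (u, v) ↦ Φ_x u + Φ'_x v`. -/
def Gam (φ : C2Torus) {N : ℕ} (x : Fin N → Torus) : PairSpace N →L[ℝ] L2 :=
  spikeOp φ.cont x ∘L WithLp.fstL 2 ℝ _ _ + spikeOp φ.contDeriv x ∘L WithLp.sndL 2 ℝ _ _

/-- `Γ_x* Γ_x`, an endomorphism of `ℝ²ᴺ`. -/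
def gramGam (φ : C2Torus) {N : ℕ} (x : Fin N → Torus) : PairSpace N →L[ℝ] PairSpace N :=
  ContinuousLinearMap.adjoint (Gam φ x) ∘L Gam φ x

/-- The vector `(sign a, 0)` of `ℝ²ᴺ`. -/
def signZero {N : ℕ} (a : Fin N → ℝ) : PairSpace N :=
  WithLp.toLp 2 (WithLp.toLp 2 (fun i => Real.sign (a i)), 0)

end SparseSpikes

end

/-! `Φ` is adjoint to `Φ*`, so under the source condition the dual solutions are exactly the `p`
with `Φ* p ∈ ∂‖m₀‖_TV`, i.e. `‖Φ* p‖_∞ ≤ 1` and `Φ* p = sign a₀` at the spikes. Each spike is then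
an extremum of `Φ* p`, so the derivative vanishes there and every dual solution satisfies the
constraints defining `p_V`.

Conversely let `q` satisfy those constraints. The perturbation `η₀ + ε Φ*(q - p₀)` has the same
values and derivatives as `η₀` at the spikes. Since `η₀'' ≠ 0` there, a second-order argument keeps
it in `[-1, 1]` near the spikes for small `ε`; elsewhere `|η₀| < 1` and compactness suffice. Hence
`p₀ + ε (q - p₀)` is a dual solution for small `ε > 0`, so its norm is at least `‖p₀‖`, and
convexity of the norm along the segment gives `‖p₀‖ ≤ ‖q‖`. Thus `p₀ = p_V`, which is the
least-norm solution of `Γ* p = (sign a₀, 0)`, namely `Γ (Γ* Γ)⁻¹ (sign a₀, 0)`.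
-/

namespace SparseSpikes

open MeasureTheory Filter Topology

section MinimalNorm

theorem eq_of_forall_mem_norm_le {E : Type*} [NormedAddCommGroup E] [NormedSpace ℝ E]
    [StrictConvexSpace ℝ E] {S : Set E} (hS : Convex ℝ S) {p q : E} (hp : p ∈ S) (hq : q ∈ S)
    (hpmin : ∀ r ∈ S, ‖p‖ ≤ ‖r‖) (hqmin : ∀ r ∈ S, ‖q‖ ≤ ‖r‖) : p = q := by
  have hmid : (1 / 2 : ℝ) • (p + q) ∈ S := by
    rw [smul_add]
    exact hS hp hq (by norm_num) (by norm_num) (by norm_num)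
  by_contra hne
  exact (hpmin _ hmid).not_gt
    ((norm_midpoint_lt_iff ((hpmin q hq).antisymm (hqmin p hp))).2 hne)

theorem norm_le_of_norm_le_of_mem_openSegment {E : Type*} [NormedAddCommGroup E]
    [NormedSpace ℝ E] {p q r : E} (hr : r ∈ openSegment ℝ p q) (h : ‖p‖ ≤ ‖r‖) : ‖p‖ ≤ ‖q‖ :=
  h.trans (convexOn_univ_norm.le_right_of_left_le (Set.mem_univ p) (Set.mem_univ q) hr h)

variable {E F : Type*} [NormedAddCommGroup E] [InnerProductSpace ℝ E] [CompleteSpace E]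
  [NormedAddCommGroup F] [InnerProductSpace ℝ F] [CompleteSpace F]

theorem exists_mem_forall_norm_le {S : Set E} (hne : S.Nonempty) (hcl : IsClosed S)
    (hconv : Convex ℝ S) : ∃ p ∈ S, ∀ q ∈ S, ‖p‖ ≤ ‖q‖ := by
  obtain ⟨p, hp, hmin⟩ := exists_norm_eq_iInf_of_complete_convex hne hcl.isComplete hconv 0
  simp only [zero_sub, norm_neg] at hmin
  refine ⟨p, hp, fun q hq => hmin.trans_le ?_⟩
  exact ciInf_le ⟨0, Set.forall_mem_range.2 fun _ => norm_nonneg _⟩ (⟨q, hq⟩ : S)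

theorem norm_apply_le_of_adjoint_apply_eq {A : E →L[ℝ] F} {w : E} {q : F}
    (h : A.adjoint q = A.adjoint (A w)) : ‖A w‖ ≤ ‖q‖ := by
  have hsq : ‖A w‖ * ‖A w‖ ≤ ‖A w‖ * ‖q‖ :=
    calc ‖A w‖ * ‖A w‖ = inner ℝ (A w) q := by
          rw [← real_inner_self_eq_norm_mul_norm, ← A.adjoint_inner_right, ← h,
            A.adjoint_inner_right]
      _ ≤ ‖A w‖ * ‖q‖ := real_inner_le_norm _ _
  rcases (norm_nonneg (A w)).eq_or_lt with h0 | hpos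
  · exact h0 ▸ norm_nonneg q
  · exact le_of_mul_le_mul_left hsq hpos

theorem isInvertible_adjoint_comp_self [FiniteDimensional ℝ E] {A : E →L[ℝ] F}
    (hA : Function.Injective A) : (A.adjoint ∘L A).IsInvertible := by
  have hinj : Function.Injective (A.adjoint ∘L A).toLinearMap :=
    A.adjoint_comp_self_injective_iff.2 hA
  exact ⟨(LinearEquiv.ofInjectiveEndo _ hinj).toContinuousLinearEquiv, rfl⟩

end MinimalNorm

section NondegenerateMaximum

variable {f g : ℝ → ℝ} {u : ℝ}

theorem deriv_deriv_nonpos_of_isLocalMax (hmax : IsLocalMax f u) (hf : ContinuousAt f u) :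
    deriv (deriv f) u ≤ 0 := by
  by_contra! hpos
  -- Otherwise `u` is also a local minimum, so `f` is locally constant and `f'' u = 0`.
  have hmin : IsLocalMin f u := isLocalMin_of_deriv_deriv_pos hpos hmax.deriv_eq_zero hf
  have hconst : f =ᶠ[𝓝 u] fun _ => f u := by
    filter_upwards [hmin, hmax] with v h₁ h₂ using le_antisymm h₂ h₁
  exact hpos.ne' (hconst.deriv.deriv.eq_of_nhds.trans (by simp only [deriv_const']))

theorem isMaxOn_of_deriv_deriv_neg {s : Set ℝ} (hs : Convex ℝ s) (hu : u ∈ s)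
    (hf : Differentiable ℝ f) (hf' : Differentiable ℝ (deriv f)) (hfu : deriv f u = 0)
    (hneg : ∀ v ∈ s, deriv (deriv f) v < 0) : IsMaxOn f s u :=
  have hlocal : IsLocalMax f u :=
    isLocalMax_of_deriv_deriv_neg (hneg u hu) hfu hf.continuous.continuousAt
  IsMaxOn.of_isLocalMaxOn_of_concaveOn hu (hlocal.on s)
    (concaveOn_of_deriv2_nonpos' hs hf.differentiableOn hf'.differentiableOn
      fun v hv => (hneg v hv).le)

theorem differentiable_deriv_of_contDiff_two (hf : ContDiff ℝ 2 f) :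
    Differentiable ℝ (deriv f) :=
  ((contDiff_succ_iff_deriv (n := 1)).1 hf).2.2.differentiable one_ne_zero

theorem continuous_deriv_deriv_of_contDiff_two (hf : ContDiff ℝ 2 f) :
    Continuous (deriv (deriv f)) :=
  ((contDiff_succ_iff_deriv (n := 1)).1 hf).2.2.continuous_deriv le_rfl

theorem deriv_add_mul (hf : Differentiable ℝ f) (hg : Differentiable ℝ g) (ε : ℝ) :
    deriv (fun v => f v + ε * g v) = fun v => deriv f v + ε * deriv g v := by
  funext v
  rw [deriv_fun_add (hf v) ((hg v).const_mul ε), deriv_const_mul ε (hg v)]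

theorem eventually_add_mul_le_of_isLocalMax (hf : ContDiff ℝ 2 f) (hg : ContDiff ℝ 2 g)
    (hmax : IsLocalMax f u) (hf'' : deriv (deriv f) u ≠ 0) (hgu : g u = 0)
    (hg'u : deriv g u = 0) :
    ∀ᶠ z : ℝ × ℝ in 𝓝 (0, u), f z.2 + z.1 * g z.2 ≤ f u := by
  have hdf := hf.differentiable two_ne_zero
  have hdg := hg.differentiable two_ne_zero
  have hdf' := differentiable_deriv_of_contDiff_two hf
  have hdg' := differentiable_deriv_of_contDiff_two hg
  have hcf := continuous_deriv_deriv_of_contDiff_two hf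
  have hcg := continuous_deriv_deriv_of_contDiff_two hg
  have hneg : deriv (deriv f) u < 0 :=
    (deriv_deriv_nonpos_of_isLocalMax hmax hdf.continuous.continuousAt).lt_of_ne hf''
  have hcurv : ∀ᶠ z : ℝ × ℝ in 𝓝 (0, u), deriv (deriv f) z.2 + z.1 * deriv (deriv g) z.2 < 0 := by
    have hc : Continuous fun z : ℝ × ℝ => deriv (deriv f) z.2 + z.1 * deriv (deriv g) z.2 :=
      (hcf.comp continuous_snd).add (continuous_fst.mul (hcg.comp continuous_snd))
    exact hc.continuousAt.eventually_lt_const (by simpa using hneg)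
  obtain ⟨δ, hδ, hball⟩ := Metric.eventually_nhds_iff_ball.1 hcurv
  filter_upwards [Metric.ball_mem_nhds _ hδ] with z hz
  rw [← ball_prod_same] at hball hz
  have hderiv := deriv_add_mul hdf hdg z.1
  have hcrit : deriv (fun v => f v + z.1 * g v) u = 0 := by
    simp only [hderiv, hg'u, hmax.deriv_eq_zero, mul_zero, add_zero]
  have hdiff' : Differentiable ℝ (deriv fun v => f v + z.1 * g v) := by
    rw [hderiv]
    exact hdf'.add (hdg'.const_mul z.1)
  have hconc (v : ℝ) (hv : v ∈ Metric.ball u δ) :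
      deriv (deriv fun v => f v + z.1 * g v) v < 0 := by
    rw [hderiv, deriv_add_mul hdf' hdg']
    exact hball (z.1, v) ⟨hz.1, hv⟩
  have hle : f z.2 + z.1 * g z.2 ≤ f u + z.1 * g u :=
    isMaxOn_of_deriv_deriv_neg (f := fun v => f v + z.1 * g v) (convex_ball u δ)
      (Metric.mem_ball_self hδ) (hdf.add (hdg.const_mul z.1)) hdiff' hcrit hconc hz.2
  simpa only [hgu, mul_zero, add_zero] using hle

theorem eventually_abs_add_mul_le_of_isLocalMax_of_pos (hf : ContDiff ℝ 2 f)
    (hg : ContDiff ℝ 2 g) (hmax : IsLocalMax f u) (hpos : 0 < f u)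
    (hf'' : deriv (deriv f) u ≠ 0) (hgu : g u = 0) (hg'u : deriv g u = 0) :
    ∀ᶠ z : ℝ × ℝ in 𝓝 (0, u), |f z.2 + z.1 * g z.2| ≤ f u := by
  have hc : Continuous fun z : ℝ × ℝ => f z.2 + z.1 * g z.2 := by
    have := hf.continuous
    have := hg.continuous
    fun_prop
  have hlower : ∀ᶠ z : ℝ × ℝ in 𝓝 (0, u), -f u < f z.2 + z.1 * g z.2 :=
    hc.continuousAt.eventually_const_lt (by simpa using neg_lt_self hpos)
  filter_upwards [hlower, eventually_add_mul_le_of_isLocalMax hf hg hmax hf'' hgu hg'u]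
    with z h₁ h₂ using abs_le.2 ⟨h₁.le, h₂⟩

theorem eventually_abs_add_mul_le_of_isLocalMax_abs (hf : ContDiff ℝ 2 f) (hg : ContDiff ℝ 2 g)
    (hmax : IsLocalMax (fun v => |f v|) u) (hfu : f u ≠ 0) (hf'' : deriv (deriv f) u ≠ 0)
    (hgu : g u = 0) (hg'u : deriv g u = 0) :
    ∀ᶠ z : ℝ × ℝ in 𝓝 (0, u), |f z.2 + z.1 * g z.2| ≤ |f u| := by
  rcases hfu.lt_or_gt with hneg | hpos
  · have hmax' : IsLocalMax (-f) u := by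
      filter_upwards [hmax] with v hv
      exact (neg_le_abs _).trans (hv.trans_eq (abs_of_neg hneg))
    have hev := eventually_abs_add_mul_le_of_isLocalMax_of_pos hf.neg hg.neg hmax'
      (neg_pos.2 hneg) (by simpa [deriv.neg'] using hf'') (by simpa using hgu)
      (by simpa [deriv.neg'] using hg'u)
    filter_upwards [hev] with z hz
    rwa [abs_of_neg hneg, ← abs_neg, neg_add, ← mul_neg]
  · have hmax' : IsLocalMax f u := by
      filter_upwards [hmax] with v hv
      exact (le_abs_self _).trans (hv.trans_eq (abs_of_pos hpos))
    rw [abs_of_pos hpos]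
    exact eventually_abs_add_mul_le_of_isLocalMax_of_pos hf hg hmax' hpos hf'' hgu hg'u

end NondegenerateMaximum

section Torus

theorem torusDeriv_torusDeriv_coe (g : Torus → ℝ) (t : ℝ) :
    torusDeriv (torusDeriv g) (t : Torus) = deriv (deriv fun s : ℝ => g (s : Torus)) t := by
  simp only [C2Torus.torusDeriv_coe]

theorem torusDeriv_eq_zero_of_norm_le_abs {η : C(Torus, ℝ)} {t : Torus} (h : ‖η‖ ≤ |η t|) :
    torusDeriv η t = 0 := by
  have hle (s : Torus) : |η s| ≤ |η t| := (η.norm_coe_le_norm s).trans h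
  rcases abs_cases (η t) with ⟨ht, -⟩ | ⟨ht, -⟩
  · have hmax : IsLocalMax (fun h : ℝ => η (t + (h : Torus))) 0 := Eventually.of_forall fun v => by
      simpa using (le_abs_self _).trans ((hle (t + v)).trans_eq ht)
    exact hmax.deriv_eq_zero
  · have hmin : IsLocalMin (fun h : ℝ => η (t + (h : Torus))) 0 := Eventually.of_forall fun v => by
      simpa using neg_le.1 ((neg_le_abs _).trans ((hle (t + v)).trans_eq ht))
    exact hmin.deriv_eq_zero

theorem eventually_norm_add_smul_le_one {η ξ : C(Torus, ℝ)}
    (hη : ContDiff ℝ 2 fun t : ℝ => η (t : Torus)) (hξ : ContDiff ℝ 2 fun t : ℝ => ξ (t : Torus))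
    (hle : ‖η‖ ≤ 1)
    (hsat : ∀ t, |η t| = 1 →
      torusDeriv (torusDeriv η) t ≠ 0 ∧ ξ t = 0 ∧ torusDeriv ξ t = 0) :
    ∀ᶠ ε : ℝ in 𝓝 0, ‖η + ε • ξ‖ ≤ 1 := by
  have hle' (t : Torus) : |η t| ≤ 1 := (η.norm_coe_le_norm t).trans hle
  suffices hloc : ∀ t ∈ (Set.univ : Set Torus), ∀ᶠ z : ℝ × Torus in 𝓝 (0, t),
      |η z.2 + z.1 * ξ z.2| ≤ 1 by
    filter_upwards [isCompact_univ.eventually_forall_of_forall_eventually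
      (P := fun (ε : ℝ) t => |η t + ε * ξ t| ≤ 1) hloc] with ε hε
    exact (ContinuousMap.norm_le _ zero_le_one).2 fun t => hε t (Set.mem_univ t)
  intro t _
  rcases (hle' t).lt_or_eq with hlt | ht
  · have hc : Continuous fun z : ℝ × Torus => |η z.2 + z.1 * ξ z.2| := by fun_prop
    exact (hc.continuousAt.eventually_lt_const (by simpa using hlt)).mono fun _ => le_of_lt
  · obtain ⟨u, rfl⟩ := QuotientAddGroup.mk_surjective t
    obtain ⟨hη'', hξt, hξ't⟩ := hsat _ ht
    have hev := eventually_abs_add_mul_le_of_isLocalMax_abs hη hξ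
      (Eventually.of_forall fun v => (hle' v).trans_eq ht.symm)
      (abs_ne_zero.1 (ht.trans_ne one_ne_zero)) (by rwa [← torusDeriv_torusDeriv_coe]) hξt
      (by rwa [← C2Torus.torusDeriv_coe])
    have hnhds : 𝓝 ((0 : ℝ), (QuotientAddGroup.mk u : Torus)) =
        map (Prod.map id QuotientAddGroup.mk) (𝓝 (0, u)) := by
      rw [nhds_prod_eq, nhds_prod_eq, QuotientAddGroup.nhds_eq, ← prod_map_map_eq', map_id]
    rw [hnhds, eventually_map]
    filter_upwards [hev] with z hz using hz.trans_eq ht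

end Torus

section Atoms

/-- The continuous function `t ↦ ψ(x - t)` whose class in `L²(𝕋)` is `atom ψ x`. It is used to
differentiate `atom ψ` through the uniform norm. -/
def reflectedTranslate (ψ : C(Torus, ℝ)) (x : Torus) : C(Torus, ℝ) :=
  ⟨fun t => ψ (x - t), by fun_prop⟩

theorem continuous_reflectedTranslate (ψ : C(Torus, ℝ)) : Continuous (reflectedTranslate ψ) :=
  (ContinuousMap.curry ⟨fun q : Torus × Torus => ψ (q.1 - q.2), by fun_prop⟩).continuous

theorem reflectedTranslate_eq_add_integral {ψ ψ' : C(Torus, ℝ)}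
    (h : ∀ u : ℝ, HasDerivAt (fun v : ℝ => ψ (v : Torus)) (ψ' (u : Torus)) u) (u v : ℝ) :
    reflectedTranslate ψ (v : Torus) =
      reflectedTranslate ψ (u : Torus) + ∫ w in u..v, reflectedTranslate ψ' (w : Torus) := by
  have hcont : Continuous fun w : ℝ => reflectedTranslate ψ' (w : Torus) :=
    (continuous_reflectedTranslate ψ').comp (AddCircle.continuous_mk' 1)
  ext s
  obtain ⟨r, rfl⟩ := QuotientAddGroup.mk_surjective s
  have heval := (ContinuousMap.evalCLM ℝ (r : Torus)).intervalIntegral_comp_comm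
    (hcont.intervalIntegrable (μ := volume) u v)
  have hderiv (w : ℝ) : HasDerivAt (fun w : ℝ => reflectedTranslate ψ (w : Torus) (r : Torus))
      (reflectedTranslate ψ' (w : Torus) (r : Torus)) w := by
    have hcomp := (h (w - r)).comp_sub_const w r
    simp only [AddCircle.coe_sub] at hcomp
    exact hcomp
  have hcont_eval : Continuous fun w : ℝ => reflectedTranslate ψ' (w : Torus) (r : Torus) :=
    (ContinuousMap.evalCLM ℝ (r : Torus)).continuous.comp hcont
  have hftc := intervalIntegral.integral_eq_sub_of_hasDerivAt (a := u) (b := v)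
    (fun w _ => hderiv w) (hcont_eval.intervalIntegrable u v)
  exact (add_eq_of_eq_sub' (heval.symm.trans hftc)).symm

theorem hasDerivAt_reflectedTranslate {ψ ψ' : C(Torus, ℝ)}
    (h : ∀ u : ℝ, HasDerivAt (fun v : ℝ => ψ (v : Torus)) (ψ' (u : Torus)) u) (u : ℝ) :
    HasDerivAt (fun v : ℝ => reflectedTranslate ψ (v : Torus))
      (reflectedTranslate ψ' (u : Torus)) u := by
  have hcont : Continuous fun w : ℝ => reflectedTranslate ψ' (w : Torus) :=
    (continuous_reflectedTranslate ψ').comp (AddCircle.continuous_mk' 1)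
  rw [funext (reflectedTranslate_eq_add_integral h u)]
  exact (hcont.integral_hasStrictDerivAt u u).hasDerivAt.const_add _

theorem continuous_atom (ψ : C(Torus, ℝ)) : Continuous (atom ψ) :=
  (ContinuousMap.toLp 2 volume ℝ).continuous.comp (continuous_reflectedTranslate ψ)

theorem hasDerivAt_atom {ψ ψ' : C(Torus, ℝ)}
    (h : ∀ u : ℝ, HasDerivAt (fun v : ℝ => ψ (v : Torus)) (ψ' (u : Torus)) u) (u : ℝ) :
    HasDerivAt (fun v : ℝ => atom ψ (v : Torus)) (atom ψ' (u : Torus)) u :=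
  (ContinuousMap.toLp (E := ℝ) 2 (volume : Measure Torus) ℝ).hasFDerivAt.comp_hasDerivAt u
    (hasDerivAt_reflectedTranslate h u)

theorem contDiff_atom {n : ℕ} {ψ : C(Torus, ℝ)} (h : ContDiff ℝ n fun t : ℝ => ψ (t : Torus)) :
    ContDiff ℝ n fun t : ℝ => atom ψ (t : Torus) := by
  induction n generalizing ψ with
  | zero => exact contDiff_zero.2 ((continuous_atom ψ).comp (AddCircle.continuous_mk' 1))
  | succ n ih =>
    push_cast at h ⊢
    obtain ⟨hdiff, -, hderiv⟩ := contDiff_succ_iff_deriv.1 h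
    simp only [← funext (C2Torus.torusDeriv_coe ψ)] at hderiv
    let ψ' : C(Torus, ℝ) := ⟨torusDeriv ψ, C2Torus.continuous_of_lift hderiv.continuous⟩
    have hψ' (u : ℝ) : HasDerivAt (fun v : ℝ => ψ (v : Torus)) (ψ' (u : Torus)) u :=
      (hdiff u).hasDerivAt.congr_deriv (C2Torus.torusDeriv_coe ψ u).symm
    have hatom := hasDerivAt_atom hψ'
    refine contDiff_succ_iff_deriv.2 ⟨fun u => (hatom u).differentiableAt, by simp, ?_⟩
    rw [funext fun u => (hatom u).deriv]
    exact ih hderiv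

theorem C2Torus.hasDerivAt_cont (φ : C2Torus) (u : ℝ) :
    HasDerivAt (fun v : ℝ => φ.cont (v : Torus)) (φ.contDeriv (u : Torus)) u :=
  (φ.contDiff.differentiable two_ne_zero u).hasDerivAt.congr_deriv
    (C2Torus.torusDeriv_coe φ.toFun u).symm

end Atoms

section Adjoint

theorem phiAdj_apply (φ : C2Torus) (p : L2) (t : Torus) :
    PhiAdj φ p t = inner ℝ (atom φ.cont t) p := by
  rw [L2.inner_def]
  refine integral_congr_ae ?_
  filter_upwards [ContinuousMap.coeFn_toLp (p := 2) (𝕜 := ℝ) (volume : Measure Torus)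
    (reflectedTranslate φ.cont t)] with s hs
  have hatom : atom φ.cont t s = φ.cont (t - s) := hs
  simp [hatom, mul_comm]

theorem phiAdj_add_smul (φ : C2Torus) (p q : L2) (c : ℝ) :
    PhiAdj φ (p + c • q) = PhiAdj φ p + c • PhiAdj φ q := by
  ext t
  simp [phiAdj_apply, inner_add_right, inner_smul_right]

theorem contDiff_phiAdj (φ : C2Torus) (p : L2) :
    ContDiff ℝ 2 fun t : ℝ => PhiAdj φ p (t : Torus) := by
  simp only [phiAdj_apply]
  exact (contDiff_atom (n := 2) φ.contDiff).inner ℝ contDiff_const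

theorem torusDeriv_phiAdj (φ : C2Torus) (p : L2) (t : Torus) :
    torusDeriv (PhiAdj φ p) t = inner ℝ (atom φ.contDeriv t) p := by
  obtain ⟨u, rfl⟩ := QuotientAddGroup.mk_surjective t
  have hderiv := (hasDerivAt_atom φ.hasDerivAt_cont u).inner ℝ (hasDerivAt_const u p)
  simp only [← phiAdj_apply, inner_zero_right, zero_add] at hderiv
  exact (C2Torus.torusDeriv_coe _ u).trans hderiv.deriv

theorem inner_phi (φ : C2Torus) (m : RadonMeasure) (p : L2) :
    inner ℝ (Phi φ m) p = m (PhiAdj φ p) := by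
  let translate : C(Torus, C(Torus, ℝ)) :=
    ContinuousMap.curry ⟨fun q : Torus × Torus => φ.cont (q.2 - q.1), by fun_prop⟩
  have hp : Integrable p volume := (Lp.memLp p).integrable one_le_two
  have hint : Integrable (fun t => p t • translate t) volume :=
    hp.smul_bdd ‖translate‖ translate.continuous.aestronglyMeasurable
      (Eventually.of_forall translate.norm_coe_le_norm)
  have hadj : ∫ t, p t • translate t = PhiAdj φ p := by
    ext x
    rw [ContinuousMap.integral_apply hint]
    exact integral_congr_ae (Eventually.of_forall fun t => mul_comm _ _)
  rw [← hadj, ← m.integral_comp_comm hint, L2.inner_def]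
  refine integral_congr_ae ?_
  filter_upwards [ContinuousMap.coeFn_toLp (p := 2) (𝕜 := ℝ) (volume : Measure Torus)
    ⟨fun t => m (translate t), by fun_prop⟩] with t ht
  have hPhi : Phi φ m t = m (translate t) := ht
  simp [hPhi]

end Adjoint

section TotalVariation

theorem norm_evalCLM_le_one {X : Type*} [TopologicalSpace X] [CompactSpace X] (t : X) :
    ‖(ContinuousMap.evalCLM ℝ t : C(X, ℝ) →L[ℝ] ℝ)‖ ≤ 1 :=
  ContinuousLinearMap.opNorm_le_bound _ zero_le_one fun ψ => by
    simpa using ψ.norm_coe_le_norm t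

theorem apply_le_norm_of_norm_le_one {E : Type*} [SeminormedAddCommGroup E] [NormedSpace ℝ E]
    (m : E →L[ℝ] ℝ) {η : E} (hη : ‖η‖ ≤ 1) : m η ≤ ‖m‖ :=
  (le_abs_self _).trans (m.unit_le_opNorm η hη)

theorem mem_subdiffTV_iff {m : RadonMeasure} {η : C(Torus, ℝ)} :
    η ∈ subdiffTV m ↔ ‖η‖ ≤ 1 ∧ m η = ‖m‖ := by
  constructor
  · intro h
    have hη : ‖η‖ ≤ 1 := by
      refine (ContinuousMap.norm_le _ zero_le_one).2 fun t => ?_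
      let δ : RadonMeasure := ContinuousMap.evalCLM ℝ t
      have hδ : ‖δ‖ ≤ 1 := norm_evalCLM_le_one t
      have hadd : ‖m‖ + η t ≤ ‖m + δ‖ := by simpa [δ] using h (m + δ)
      have hsub : ‖m‖ + -η t ≤ ‖m - δ‖ := by simpa [δ] using h (m - δ)
      exact abs_le.2 ⟨by linarith [norm_sub_le m δ], by linarith [norm_add_le m δ]⟩
    have hzero : ‖m‖ ≤ m η := by
      have h₀ := h 0
      rw [ContinuousLinearMap.opNorm_zero] at h₀
      simpa using h₀
    exact ⟨hη, (apply_le_norm_of_norm_le_one m hη).antisymm hzero⟩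
  · rintro ⟨hη, hm⟩ m'
    rw [sub_apply, hm, add_sub_cancel]
    exact apply_le_norm_of_norm_le_one m' hη

theorem discreteMeasure_apply {N : ℕ} (a : Fin N → ℝ) (x : Fin N → Torus) (η : C(Torus, ℝ)) :
    discreteMeasure a x η = ∑ i, a i * η (x i) := by
  simp [discreteMeasure]

theorem mul_sign_eq_abs (r : ℝ) : r * Real.sign r = |r| := by
  rcases lt_trichotomy r 0 with h | rfl | h
  · rw [Real.sign_of_neg h, abs_of_neg h, mul_neg_one]
  · simp
  · rw [Real.sign_of_pos h, abs_of_pos h, mul_one]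

theorem exists_norm_le_one_forall_apply_eq_sign {ι X : Type*} [Finite ι] [TopologicalSpace X]
    [CompactSpace X] [T2Space X] (a : ι → ℝ) {x : ι → X} (hx : Function.Injective x) :
    ∃ η : C(X, ℝ), ‖η‖ ≤ 1 ∧ ∀ i, η (x i) = Real.sign (a i) := by
  let : TopologicalSpace ι := ⊥
  have : DiscreteTopology ι := ⟨rfl⟩
  have hembed : IsClosedEmbedding x :=
    continuous_of_discreteTopology.isClosedEmbedding hx
  obtain ⟨η, hη, hηx⟩ := ContinuousMap.exists_extension_forall_mem_of_isClosedEmbedding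
    ⟨fun i => Real.sign (a i), continuous_of_discreteTopology⟩ (t := Set.Icc (-1) 1)
    (fun i => by rcases Real.sign_apply_eq (a i) with h | h | h <;> simp [h])
    ⟨0, by simp⟩ hembed
  exact ⟨η, (ContinuousMap.norm_le _ zero_le_one).2 fun t => abs_le.2 (hη t), congrFun hηx⟩

variable {N : ℕ} {a : Fin N → ℝ} {x : Fin N → Torus}

theorem norm_discreteMeasure (a : Fin N → ℝ) (hx : Function.Injective x) :
    ‖discreteMeasure a x‖ = ∑ i, |a i| := by
  refine le_antisymm ?_ ?_
  · refine norm_sum_le_of_le (f := fun i => a i • (ContinuousMap.evalCLM ℝ (x i) : RadonMeasure))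
      _ fun i _ => ?_
    exact (ContinuousLinearMap.opNorm_smul_le _ _).trans
      (mul_le_of_le_one_right (abs_nonneg _) (norm_evalCLM_le_one (x i)))
  · obtain ⟨η, hη, hηx⟩ := exists_norm_le_one_forall_apply_eq_sign a hx
    calc ∑ i, |a i| = discreteMeasure a x η := by
          simp only [discreteMeasure_apply, hηx, mul_sign_eq_abs]
      _ ≤ ‖discreteMeasure a x‖ := apply_le_norm_of_norm_le_one _ hη

theorem mem_subdiffTV_discreteMeasure_iff (ha : ∀ i, a i ≠ 0) (hx : Function.Injective x)
    {η : C(Torus, ℝ)} :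
    η ∈ subdiffTV (discreteMeasure a x) ↔ ‖η‖ ≤ 1 ∧ ∀ i, η (x i) = Real.sign (a i) := by
  rw [mem_subdiffTV_iff, discreteMeasure_apply, norm_discreteMeasure a hx]
  refine and_congr_right fun hη => ?_
  have hle (i : Fin N) : a i * η (x i) ≤ |a i| := by
    refine (le_abs_self _).trans ?_
    rw [abs_mul]
    exact mul_le_of_le_one_right (abs_nonneg _) ((η.norm_coe_le_norm _).trans hη)
  rw [Finset.sum_eq_sum_iff_of_le fun i _ => hle i]
  simp only [Finset.mem_univ, forall_const, ← mul_sign_eq_abs, mul_right_inj' (ha _)]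

end TotalVariation

section DualProblem

variable {φ : C2Torus} {m : RadonMeasure}

theorem mem_dualSolutions_phi_iff (hsc : SourceCondition φ m) {p : L2} :
    p ∈ dualSolutions φ (Phi φ m) ↔ PhiAdj φ p ∈ subdiffTV m := by
  simp only [dualSolutions, Set.mem_ofPred_eq, inner_phi, mem_subdiffTV_iff]
  refine and_congr_right fun hp => ⟨fun hmax => ?_, fun hm q hq => ?_⟩
  · obtain ⟨q, hq⟩ := hsc
    obtain ⟨hq_le, hmq⟩ := mem_subdiffTV_iff.1 hq
    exact (apply_le_norm_of_norm_le_one m hp).antisymm (hmq.ge.trans (hmax q hq_le))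
  · exact (apply_le_norm_of_norm_le_one m hq).trans_eq hm.symm

theorem dualSolutions_phi_eq_iInter (hsc : SourceCondition φ m) :
    dualSolutions φ (Phi φ m) =
      ⋂ m' : RadonMeasure, {p | innerSL ℝ (Phi φ (m' - m)) p ≤ ‖m'‖ - ‖m‖} := by
  ext p
  simp only [mem_dualSolutions_phi_iff hsc, subdiffTV, Set.mem_iInter, Set.mem_ofPred_eq,
    innerSL_apply_apply, inner_phi, le_sub_iff_add_le']

theorem isClosed_dualSolutions_phi (hsc : SourceCondition φ m) :
    IsClosed (dualSolutions φ (Phi φ m)) := by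
  rw [dualSolutions_phi_eq_iInter hsc]
  exact isClosed_iInter fun m' => isClosed_le (by fun_prop) continuous_const

theorem convex_dualSolutions_phi (hsc : SourceCondition φ m) :
    Convex ℝ (dualSolutions φ (Phi φ m)) := by
  rw [dualSolutions_phi_eq_iInter hsc]
  exact convex_iInter fun m' => convex_halfSpace_le
    (innerSL ℝ (Phi φ (m' - m))).toLinearMap.isLinear _

theorem IsMinNorm.eq {S : Set L2} (hS : Convex ℝ S) {p q : L2} (hp : IsMinNorm S p)
    (hq : IsMinNorm S q) : p = q :=
  eq_of_forall_mem_norm_le hS hp.1 hq.1 hp.2 hq.2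

theorem existsUnique_isMinNorm_dualSolutions_phi (hsc : SourceCondition φ m) :
    ∃! p₀, IsMinNorm (dualSolutions φ (Phi φ m)) p₀ := by
  have hconv := convex_dualSolutions_phi hsc
  have hne : (dualSolutions φ (Phi φ m)).Nonempty :=
    hsc.imp fun _ => (mem_dualSolutions_phi_iff hsc).2
  obtain ⟨p, hp⟩ := exists_mem_forall_norm_le hne (isClosed_dualSolutions_phi hsc) hconv
  exact ⟨p, hp, fun q hq => IsMinNorm.eq hconv hq hp⟩

end DualProblem

section VanishingDerivative

variable {φ : C2Torus} {N : ℕ} {a : Fin N → ℝ} {x : Fin N → Torus}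

theorem inner_gam (φ : C2Torus) (x : Fin N → Torus) (w : PairSpace N) (p : L2) :
    inner ℝ (Gam φ x w) p =
      ∑ i, w.fst i * PhiAdj φ p (x i) + ∑ i, w.snd i * torusDeriv (PhiAdj φ p) (x i) := by
  simp [Gam, spikeOp, torusDeriv_phiAdj, phiAdj_apply, inner_add_left, sum_inner,
    inner_smul_left]

theorem adjoint_gam_apply (φ : C2Torus) (x : Fin N → Torus) (p : L2) :
    (Gam φ x).adjoint p = WithLp.toLp 2 (WithLp.toLp 2 fun i => PhiAdj φ p (x i),
      WithLp.toLp 2 fun i => torusDeriv (PhiAdj φ p) (x i)) := by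
  refine ext_inner_left ℝ fun w => ?_
  rw [ContinuousLinearMap.adjoint_inner_right, inner_gam]
  simp [WithLp.prod_inner_apply, PiLp.inner_apply, mul_comm]

theorem mem_vanishingConstraints_iff {p : L2} :
    p ∈ vanishingConstraints φ a x ↔ (Gam φ x).adjoint p = signZero a := by
  rw [adjoint_gam_apply, signZero]
  simp [vanishingConstraints, funext_iff, forall_and, WithLp.ext_iff]

theorem convex_vanishingConstraints (φ : C2Torus) (a : Fin N → ℝ) (x : Fin N → Torus) :
    Convex ℝ (vanishingConstraints φ a x) := by
  have hpreimage : vanishingConstraints φ a x = (Gam φ x).adjoint ⁻¹' {signZero a} :=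
    Set.ext fun _ => mem_vanishingConstraints_iff
  rw [hpreimage]
  exact (convex_singleton _).linear_preimage (Gam φ x).adjoint.toLinearMap

theorem isInvertible_gramGam (hΓ : Function.Injective (Gam φ x)) :
    (gramGam φ x).IsInvertible :=
  have : FiniteDimensional ℝ (PairSpace N) :=
    (WithLp.linearEquiv 2 ℝ _).symm.finiteDimensional
  isInvertible_adjoint_comp_self hΓ

theorem isMinNorm_vanishingConstraints_gam_inverse (a : Fin N → ℝ)
    (hΓ : Function.Injective (Gam φ x)) :
    IsMinNorm (vanishingConstraints φ a x)
      (Gam φ x ((gramGam φ x).inverse (signZero a))) := by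
  have hsolve : (Gam φ x).adjoint (Gam φ x ((gramGam φ x).inverse (signZero a))) = signZero a :=
    (isInvertible_gramGam hΓ).self_apply_inverse (signZero a)
  refine ⟨mem_vanishingConstraints_iff.2 hsolve, fun q hq => ?_⟩
  exact norm_apply_le_of_adjoint_apply_eq ((mem_vanishingConstraints_iff.1 hq).trans hsolve.symm)

theorem mem_vanishingConstraints_of_phiAdj_mem_subdiffTV (ha : ∀ i, a i ≠ 0)
    (hx : Function.Injective x) {p : L2} (hp : PhiAdj φ p ∈ subdiffTV (discreteMeasure a x)) :
    p ∈ vanishingConstraints φ a x := by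
  obtain ⟨hle, hsign⟩ := (mem_subdiffTV_discreteMeasure_iff ha hx).1 hp
  refine fun i => ⟨hsign i, torusDeriv_eq_zero_of_norm_le_abs (hle.trans_eq ?_)⟩
  rcases Real.sign_apply_eq_of_ne_zero _ (ha i) with h | h <;> simp [hsign i, h]

theorem phiAdj_sub_apply_eq_zero {p q : L2} (hp : p ∈ vanishingConstraints φ a x)
    (hq : q ∈ vanishingConstraints φ a x) (i : Fin N) :
    PhiAdj φ (q - p) (x i) = 0 ∧ torusDeriv (PhiAdj φ (q - p)) (x i) = 0 := by
  have hval := (hq i).1.trans (hp i).1.symm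
  have hder := (hq i).2.trans (hp i).2.symm
  simp only [phiAdj_apply, torusDeriv_phiAdj] at hval hder ⊢
  simp only [inner_sub_right, hval, hder, sub_self, and_self]

theorem eventually_phiAdj_add_smul_mem_subdiffTV (ha : ∀ i, a i ≠ 0) (hx : Function.Injective x)
    {p q : L2} (hp : PhiAdj φ p ∈ subdiffTV (discreteMeasure a x))
    (hlt : ∀ s, s ∉ Set.range x → |PhiAdj φ p s| < 1)
    (hne : ∀ i, torusDeriv (torusDeriv (PhiAdj φ p)) (x i) ≠ 0)
    (hq : ∀ i, PhiAdj φ q (x i) = 0 ∧ torusDeriv (PhiAdj φ q) (x i) = 0) :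
    ∀ᶠ ε : ℝ in 𝓝 0, PhiAdj φ (p + ε • q) ∈ subdiffTV (discreteMeasure a x) := by
  obtain ⟨hle, hsign⟩ := (mem_subdiffTV_discreteMeasure_iff ha hx).1 hp
  have hsat (t : Torus) (ht : |PhiAdj φ p t| = 1) :
      torusDeriv (torusDeriv (PhiAdj φ p)) t ≠ 0 ∧
        PhiAdj φ q t = 0 ∧ torusDeriv (PhiAdj φ q) t = 0 := by
    obtain ⟨i, rfl⟩ : t ∈ Set.range x := by_contra fun h => (hlt t h).ne ht
    exact ⟨hne i, hq i⟩
  filter_upwards [eventually_norm_add_smul_le_one (contDiff_phiAdj φ p) (contDiff_phiAdj φ q)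
    hle hsat] with ε hε
  rw [phiAdj_add_smul, mem_subdiffTV_discreteMeasure_iff ha hx]
  exact ⟨hε, fun i => by simp [hsign i, (hq i).1]⟩

theorem isMinNorm_vanishingConstraints_of_isMinNorm_dualSolutions (ha : ∀ i, a i ≠ 0)
    (hx : Function.Injective x) (hnd : NonDegenerateSourceCondition φ a x) {p : L2}
    (hp : IsMinNorm (dualSolutions φ (Phi φ (discreteMeasure a x))) p) :
    IsMinNorm (vanishingConstraints φ a x) p := by
  obtain ⟨hlt, hne⟩ := hnd.2 _ ⟨p, hp, rfl⟩
  have hpsub := (mem_dualSolutions_phi_iff hnd.1).1 hp.1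
  have hpV := mem_vanishingConstraints_of_phiAdj_mem_subdiffTV ha hx hpsub
  refine ⟨hpV, fun q hq => ?_⟩
  have hev := eventually_phiAdj_add_smul_mem_subdiffTV ha hx hpsub hlt hne
    (phiAdj_sub_apply_eq_zero hpV hq)
  obtain ⟨ε, hεsub, hε⟩ := ((hev.filter_mono nhdsWithin_le_nhds).and
    (Ioo_mem_nhdsGT (zero_lt_one (α := ℝ)))).exists
  have hmem : p + ε • (q - p) ∈ openSegment ℝ p q := by
    rw [openSegment_eq_image']
    exact ⟨ε, hε, rfl⟩
  exact norm_le_of_norm_le_of_mem_openSegment hmem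
    (hp.2 _ ((mem_dualSolutions_phi_iff hnd.1).2 hεsub))

end VanishingDerivative

end SparseSpikes

theorem mainTheorem2 (φ : SparseSpikes.C2Torus) (N : ℕ) (a : Fin N → ℝ)
    (x : Fin N → SparseSpikes.Torus) (ha : ∀ i, a i ≠ 0) (hx : Function.Injective x)
    (hΓ : Function.Injective (SparseSpikes.Gam φ x))
    (hnd : SparseSpikes.NonDegenerateSourceCondition φ a x) :
    (∃! p₀, SparseSpikes.IsMinNorm
      (SparseSpikes.dualSolutions φ (SparseSpikes.Phi φ (SparseSpikes.discreteMeasure a x))) p₀) ∧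
    (∃! pV, SparseSpikes.IsMinNorm (SparseSpikes.vanishingConstraints φ a x) pV) ∧
    (SparseSpikes.gramGam φ x).IsInvertible ∧
    ∀ η₀ ηV,
      SparseSpikes.IsMinNormCertificate φ
        (SparseSpikes.Phi φ (SparseSpikes.discreteMeasure a x)) η₀ →
      SparseSpikes.IsVanishingDerivativePrecertificate φ a x ηV →
      ηV = η₀ ∧
      η₀ = SparseSpikes.PhiAdj φ (SparseSpikes.Gam φ x
        ((SparseSpikes.gramGam φ x).inverse (SparseSpikes.signZero a))) := by
  have hV := SparseSpikes.isMinNorm_vanishingConstraints_gam_inverse a hΓ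
  have hconv := SparseSpikes.convex_vanishingConstraints φ a x
  refine ⟨SparseSpikes.existsUnique_isMinNorm_dualSolutions_phi hnd.1,
    ⟨_, hV, fun q hq => hq.eq hconv hV⟩, SparseSpikes.isInvertible_gramGam hΓ, ?_⟩
  rintro _ _ ⟨p₀, hp₀, rfl⟩ ⟨pV, hpV, rfl⟩
  have h₀V := SparseSpikes.isMinNorm_vanishingConstraints_of_isMinNorm_dualSolutions ha hx hnd hp₀
  exact ⟨congrArg _ (hpV.eq hconv h₀V), congrArg _ (h₀V.eq hconv hV)⟩
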